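/- Let $n\ge 1$ and $m\ge 0$ be integers; $\mathbb{R}^n$, $\mathbb{R}^m$ and $\mathbb{R}^n\times\mathbb{R}^m$ carry their Euclidean norms, $\mathbb{B}$ is the closed unit ball of $\mathbb{R}^m$, and $\operatorname{gph} S=\{(x,y): y\in S(x)\}$ for a set-valued map $S:\mathbb{R}^n\rightrightarrows\mathbb{R}^m$. A map $H:\mathbb{R}^n\rightrightarrows\mathbb{R}^m$ is positively homogeneous if $H(0)$ is a cone (a set that contains $0$ and is closed under multiplication by positive scalars) and $H(kw)=kH(w)$ for all $k>0$ and $w\in\mathbb{R}^n$. It is a prefan if it is positively homogeneous, $H(p)$ is nonempty, convex and compact for every $p$, and $\sup_{\|w\|\le 1}\sup_{z\in H(w)}\|z\|<\infty$. For $(\bar x,\bar y)\in\operatorname{gph} S$ and positively homogeneous $H$, the map $S$ is pseudo strictly $H$-differentiable at $(\bar x,\bar y)$ if for every $\delta>0$ there are neighborhoods $U$ of $\bar x$ and $V$ of $\bar y$ such that $$S(x)\cap V\subset S(x')+H(x-x')+\delta\|x-x'\|\mathbb{B}\qquad\text{for all } x,x'\in U.$$ $S$ has the Aubin property at $(\bar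 x,\bar y)$ if this holds with $H(w)=\kappa\|w\|\mathbb{B}$ for some $\kappa\ge 0$. $S$ is locally closed at $(\bar x,\bar y)$ if the intersection of $\operatorname{gph} S$ with some closed ball of positive radius centered at $(\bar x,\bar y)$ is closed. For a set $C$ in a Euclidean space and $\bar z\in C$, let $\hat N_C(\bar z)$ be the set of all $w$ with $\langle w,z-\bar z\rangle\le o(\|z-\bar z\|)$ for $z\in C$, and let $N_C(\bar z)$ be the set of all limits $\lim_i w_i$ with $w_i\in\hat N_C(z_i)$, $z_i\in C$, $z_i\to\bar z$. The limiting coderivative $D^*S(\bar x\mid\bar y):\mathbb{R}^m\rightrightarrows\mathbb{R}^n$ is given by $v\in D^*S(\bar x\mid\bar y)(u)$ if and only if $(v,-u)\in N_{\operatorname{gph} S}(\bar x,\bar y)$, and the convexified coderivative $\operatorname{cl}\operatorname{co}D^*S(\bar x\mid\bar y)$ is the map that sends $u$ to the closed convex hull of $D^*S(\bar x\mid\bar y)(u)$. **Theorem.** Suppose $S:\mathbb{R}^n\rightrightarrows\mathbb{R}^m$ is locally closed at $(\bar x,\bar y)\in\operatorname{gph} S$ and has the Aubin property there. Then the convexified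 coderivative $\operatorname{cl}\operatorname{co}D^*S(\bar x\mid\bar y)$ is uniquely determined by the set of all prefans $H:\mathbb{R}^n\rightrightarrows\mathbb{R}^m$ such that $S$ is pseudo strictly $H$-differentiable at $(\bar x,\bar y)$. That is, if $S_1,S_2:\mathbb{R}^n\rightrightarrows\mathbb{R}^m$ are locally closed and have the Aubin property at $(\bar x_1,\bar y_1)\in\operatorname{gph} S_1$ and $(\bar x_2,\bar y_2)\in\operatorname{gph} S_2$ respectively, and if for every prefan $H:\mathbb{R}^n\rightrightarrows\mathbb{R}^m$ the map $S_1$ is pseudo strictly $H$-differentiable at $(\bar x_1,\bar y_1)$ if and only if $S_2$ is pseudo strictly $H$-differentiable at $(\bar x_2,\bar y_2)$, then $$\operatorname{cl}\operatorname{co}D^*S_1(\bar x_1\mid\bar y_1)(u)=\operatorname{cl}\operatorname{co}D^*S_2(\bar x_2\mid\bar y_2)(u)\qquad\text{for all }u\in\mathbb{R}^m.$$ -/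

import Mathlib

open Filter Topology
open scoped Pointwise ENNReal

namespace VarAnalysis

section Maps

variable {X Y : Type*} [NormedAddCommGroup X] [NormedSpace ℝ X]
  [NormedAddCommGroup Y] [NormedSpace ℝ Y]

/-- A cone: a set containing the origin and stable under multiplication by positive scalars. -/
def IsCone (C : Set Y) : Prop :=
  (0 : Y) ∈ C ∧ ∀ k : ℝ, 0 < k → ∀ z ∈ C, k • z ∈ C

/-- Positive homogeneity of a set-valued map `H : X ⇉ Y`. -/
def PosHomogeneous (H : X → Set Y) : Prop :=
  IsCone (H 0) ∧ ∀ k : ℝ, 0 < k → ∀ w : X, H (k • w) = k • H w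

/-- The outer norm `‖H‖⁺`, with values in `[0, ∞]`. -/
noncomputable def outerNorm (H : X → Set Y) : ℝ≥0∞ :=
  ⨆ (w : X) (_ : ‖w‖ ≤ 1), ⨆ z ∈ H w, ‖z‖ₑ

/-- A prefan: nonempty convex compact values, positively homogeneous, finite outer norm. -/
structure IsPrefan (H : X → Set Y) : Prop where
  nonempty : ∀ p, (H p).Nonempty
  convex : ∀ p, Convex ℝ (H p)
  isCompact : ∀ p, IsCompact (H p)
  posHomogeneous : PosHomogeneous H
  outerNorm_lt_top : outerNorm H < ⊤

/-- The map `w ↦ κ‖w‖𝔹`, where `𝔹` is the closed unit ball of `Y`. -/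
def ballMap (X Y : Type*) [NormedAddCommGroup X] [NormedAddCommGroup Y] [NormedSpace ℝ Y]
    (κ : ℝ) : X → Set Y :=
  fun w => (κ * ‖w‖) • Metric.closedBall (0 : Y) 1

/-- The map `(H + δ)(w) = H(w) + δ‖w‖𝔹`. -/
def enlarge (H : X → Set Y) (δ : ℝ) : X → Set Y :=
  fun w => H w + ballMap X Y δ w

/-- Pseudo strict `H`-differentiability of `S` at a point `(x₀, y₀)` of its graph. -/
def PseudoStrictDiffAt (S H : X → Set Y) (x₀ : X) (y₀ : Y) : Prop :=
  ∀ δ : ℝ, 0 < δ → ∃ U ∈ 𝓝 x₀, ∃ V ∈ 𝓝 y₀, ∀ x ∈ U, ∀ x' ∈ U,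
    S x ∩ V ⊆ S x' + enlarge H δ (x - x')

/-- The Aubin (pseudo-Lipschitz) property of `S` at a point `(x₀, y₀)` of its graph. -/
def AubinAt (S : X → Set Y) (x₀ : X) (y₀ : Y) : Prop :=
  ∃ κ : ℝ, 0 ≤ κ ∧ PseudoStrictDiffAt S (ballMap X Y κ) x₀ y₀

/-- The graph of `S`, as a subset of `X × Y` with the Euclidean product norm. -/
def graph (S : X → Set Y) : Set (WithLp 2 (X × Y)) :=
  {z | z.snd ∈ S z.fst}

/-- `S` is locally closed at `(x₀, y₀)`. -/
def LocallyClosedAt (S : X → Set Y) (x₀ : X) (y₀ : Y) : Prop :=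
  ∃ ε : ℝ, 0 < ε ∧ IsClosed (graph S ∩ Metric.closedBall (WithLp.toLp 2 (x₀, y₀)) ε)

/-- The set of all prefans `H` such that `S` is pseudo strictly `H`-differentiable. -/
def prefanDerivatives (S : X → Set Y) (x₀ : X) (y₀ : Y) : Set (X → Set Y) :=
  {H | IsPrefan H ∧ PseudoStrictDiffAt S H x₀ y₀}

end Maps

section Normals

variable {Z : Type*} [NormedAddCommGroup Z] [InnerProductSpace ℝ Z]

/-- The regular normal cone: `⟨y, z - z₀⟩ ≤ o(‖z - z₀‖)` for `z ∈ C`. -/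
def regularNormalCone (C : Set Z) (z₀ : Z) : Set Z :=
  {y | ∀ ε : ℝ, 0 < ε → ∀ᶠ z in 𝓝[C] z₀, inner ℝ y (z - z₀) ≤ ε * ‖z - z₀‖}

/-- The limiting (Mordukhovich) normal cone. -/
def limitingNormalCone (C : Set Z) (z₀ : Z) : Set Z :=
  {y | ∃ (z w : ℕ → Z), (∀ i, z i ∈ C) ∧ Tendsto z atTop (𝓝 z₀) ∧
    (∀ i, w i ∈ regularNormalCone C (z i)) ∧ Tendsto w atTop (𝓝 y)}

end Normals

section Coderivatives

variable {X Y : Type*} [NormedAddCommGroup X] [InnerProductSpace ℝ X]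
  [NormedAddCommGroup Y] [InnerProductSpace ℝ Y]

/-- The limiting (Mordukhovich) coderivative `D*S(x₀ | y₀) : Y ⇉ X`. -/
def coderivative (S : X → Set Y) (x₀ : X) (y₀ : Y) : Y → Set X :=
  fun u => {v | WithLp.toLp 2 (v, -u) ∈
    limitingNormalCone (graph S) (WithLp.toLp 2 (x₀, y₀))}

/-- The convexified coderivative: `u ↦ cl co D*S(x₀ | y₀)(u)`. -/
def convexifiedCoderivative (S : X → Set Y) (x₀ : X) (y₀ : Y) : Y → Set X :=
  fun u => closure (convexHull ℝ (coderivative S x₀ y₀ u))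

end Coderivatives

end VarAnalysis

/-! Under the hypotheses, pseudo strict differentiability is a dual condition, checked one direction
$q$ at a time: $\min_{h\in H(q)}\langle u,h\rangle\le\langle v,q\rangle$ whenever $v\in D^*S(\bar
x\mid\bar y)(u)$.

Necessity (`PseudoStrictDiffAt.exists_inner_le_of_mem_coderivative`) comes from testing nearby
regular normals against the displacements that $H$ provides. Sufficiency
(`exists_sub_smul_mem_of_coderivative`) is a viability argument: the condition passes, up to
$\delta$, to nearby regular normals, and Euler polygons corrected by projection onto the graph stay
close to it.

Suppose some $v\in D^*S_2(u)$, $u\ne0$, lies outside $\operatorname{cl}\operatorname{co}D^*S_1(u)$.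
Separation gives $q$ and $c$ with $\langle v,q\rangle<c<\langle v',q\rangle$ for all $v'\in
D^*S_1(u)$. A compact convex $K\subset\{h:\langle u,h\rangle\ge c\}$ satisfying the criterion for
$S_1$ at $q$ exists (`exists_compact_convex_of_lt_coderivative`). Put $K$ on the ray of $q$ and
Aubin balls elsewhere (`rayFan`). This prefan works for $S_1$, hence for $S_2$, and necessity yields
$h\in K$ with $\langle u,h\rangle\le\langle v,q\rangle<c$, a contradiction. -/

namespace VarAnalysis

/-! ### Normal cones and viability -/

section Normals

variable {Z : Type*} [NormedAddCommGroup Z] [InnerProductSpace ℝ Z]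

theorem zero_mem_regularNormalCone (C : Set Z) (z₀ : Z) : (0 : Z) ∈ regularNormalCone C z₀ := by
  intro ε hε
  filter_upwards with z
  rw [inner_zero_left]
  positivity

theorem smul_mem_regularNormalCone {C : Set Z} {z₀ w : Z} (hw : w ∈ regularNormalCone C z₀)
    {c : ℝ} (hc : 0 < c) : c • w ∈ regularNormalCone C z₀ := by
  intro ε hε
  filter_upwards [hw (ε / c) (by positivity)] with z hz
  rw [real_inner_smul_left]
  calc c * inner ℝ w (z - z₀) ≤ c * (ε / c * ‖z - z₀‖) := by gcongr
    _ = ε * ‖z - z₀‖ := by field_simp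

theorem mem_limitingNormalCone_iff {C : Set Z} {z₀ y : Z} :
    y ∈ limitingNormalCone C z₀ ↔ ∀ ε : ℝ, 0 < ε → ∃ z ∈ C, dist z z₀ < ε ∧
      ∃ w ∈ regularNormalCone C z, dist w y < ε := by
  constructor
  · rintro ⟨z, w, hz, hzt, hw, hwt⟩ ε hε
    obtain ⟨i, h1, h2⟩ := ((Metric.tendsto_nhds.1 hzt ε hε).and
      (Metric.tendsto_nhds.1 hwt ε hε)).exists
    exact ⟨z i, hz i, h1, w i, hw i, h2⟩
  · intro h
    choose z hz hzd w hw hwd using fun i : ℕ => h (1 / ((i : ℝ) + 1)) (by positivity)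
    refine ⟨z, w, hz, ?_, hw, ?_⟩
    · rw [tendsto_iff_dist_tendsto_zero]
      exact squeeze_zero (fun _ => dist_nonneg) (fun i => (hzd i).le)
        tendsto_one_div_add_atTop_nhds_zero_nat
    · rw [tendsto_iff_dist_tendsto_zero]
      exact squeeze_zero (fun _ => dist_nonneg) (fun i => (hwd i).le)
        tendsto_one_div_add_atTop_nhds_zero_nat

theorem isClosed_limitingNormalCone (C : Set Z) (z₀ : Z) :
    IsClosed (limitingNormalCone C z₀) := by
  refine isClosed_of_closure_subset fun y hy => mem_limitingNormalCone_iff.2 fun ε hε => ?_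
  obtain ⟨y', hy', hd⟩ := Metric.mem_closure_iff.1 hy (ε / 2) (by positivity)
  obtain ⟨z, hz, hzd, w, hw, hwd⟩ := mem_limitingNormalCone_iff.1 hy' (ε / 2) (by positivity)
  refine ⟨z, hz, by linarith, w, hw, ?_⟩
  have := dist_triangle w y' y
  rw [dist_comm y y'] at hd
  linarith

theorem zero_mem_limitingNormalCone {C : Set Z} {z₀ : Z} (hz₀ : z₀ ∈ C) :
    (0 : Z) ∈ limitingNormalCone C z₀ :=
  ⟨fun _ => z₀, fun _ => 0, fun _ => hz₀, tendsto_const_nhds,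
    fun _ => zero_mem_regularNormalCone C z₀, tendsto_const_nhds⟩

theorem smul_mem_limitingNormalCone {C : Set Z} {z₀ y : Z} (hy : y ∈ limitingNormalCone C z₀)
    {c : ℝ} (hc : 0 < c) : c • y ∈ limitingNormalCone C z₀ := by
  obtain ⟨z, w, hz, hzt, hw, hwt⟩ := hy
  exact ⟨z, fun i => c • w i, hz, hzt, fun i => smul_mem_regularNormalCone (hw i) hc,
    hwt.const_smul c⟩

/-- A residual of a local metric projection is a regular normal. -/
theorem sub_mem_regularNormalCone_of_nearest {C : Set Z} {p g : Z} {r : ℝ} (hr : 0 < r)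
    (h : ∀ z ∈ C, dist z g < r → ‖p - g‖ ≤ ‖p - z‖) : p - g ∈ regularNormalCone C g := by
  intro ε hε
  have hmem : Metric.ball g (min r ε) ∈ 𝓝 g := Metric.ball_mem_nhds g (lt_min hr hε)
  filter_upwards [mem_nhdsWithin_of_mem_nhds hmem, self_mem_nhdsWithin] with z hz hzC
  have hz' : dist z g < min r ε := hz
  have h1 := h z hzC (hz'.trans_le (min_le_left _ _))
  have h2 : ‖z - g‖ < ε := by rw [← dist_eq_norm]; exact hz'.trans_le (min_le_right _ _)
  have h3 : ‖p - z‖ ^ 2 = ‖p - g‖ ^ 2 - 2 * inner ℝ (p - g) (z - g) + ‖z - g‖ ^ 2 := by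
    rw [← norm_sub_sq_real]
    congr 2
    abel
  have h4 : ‖p - g‖ ^ 2 ≤ ‖p - z‖ ^ 2 := by gcongr
  nlinarith [norm_nonneg (z - g)]

/-- If near `z₀` every regular normal to `C` makes a nonpositive inner product with
some element of the compact convex set `F`, then short trajectories in directions of `F`
can be chosen to end in `C`. -/
theorem exists_add_smul_mem_of_regularNormals [ProperSpace Z] {C F : Set Z} {z₀ : Z} {ε r M : ℝ}
    (hε : 0 < ε) (hr : 0 < r) (hclosed : IsClosed (C ∩ Metric.closedBall z₀ ε)) (hz₀ : z₀ ∈ C)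
    (hFcvx : Convex ℝ F) (hFcpt : IsCompact F) (hM : ∀ f ∈ F, ‖f‖ ≤ M)
    (hnormal : ∀ z ∈ C, dist z z₀ < r → ∀ w ∈ regularNormalCone C z, ∃ f ∈ F, inner ℝ w f ≤ 0) :
    ∃ ρ : ℝ, 0 < ρ ∧ ∀ z ∈ C, ∀ t : ℝ, 0 ≤ t → dist z z₀ + t * M < ρ →
      ∃ f ∈ F, z + t • f ∈ C := by
  obtain ⟨f₀, hf₀, -⟩ := hnormal z₀ hz₀ (by simpa using hr) 0 (zero_mem_regularNormalCone C z₀)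
  refine ⟨min ε r / 2, by positivity, fun z hz t ht hzt => ?_⟩
  set C' := C ∩ Metric.closedBall z₀ ε
  have hM0 : 0 ≤ M := (norm_nonneg f₀).trans (hM f₀ hf₀)
  have hC'cpt : IsCompact C' :=
    (isCompact_closedBall z₀ ε).of_isClosed_subset hclosed Set.inter_subset_right
  have hz₀' : z₀ ∈ C' := ⟨hz₀, Metric.mem_closedBall_self hε.le⟩
  have hzd : dist z z₀ < min ε r / 2 := by
    have : 0 ≤ t * M := by positivity
    linarith
  have hmin : min ε r / 2 ≤ min ε r := by
    have : 0 < min ε r := lt_min hε hr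
    linarith
  have hz' : z ∈ C' := ⟨hz, (hzd.trans_le (hmin.trans (min_le_left _ _))).le⟩
  -- Each Euler step starts at $p$, projects it to $g'\in C'$ and moves by $\tau f'$ with $\langle
  -- p-g',f'\rangle\le0$. The cross term has the good sign, so the squared distance to $C'$ grows by
  -- at most $(M\tau)^2$.
  have euler : ∀ τ : ℝ, 0 ≤ τ → ∀ k : ℕ, k * τ ≤ t →
      ∃ f ∈ F, ∃ g ∈ C', ‖z + (k * τ) • f - g‖ ^ 2 ≤ k * (M * τ) ^ 2 := by
    intro τ hτ k
    induction k with
    | zero => exact fun _ => ⟨f₀, hf₀, z, hz', by simp⟩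
    | succ k ih =>
      intro hk
      push_cast at hk ⊢
      have hkt : k * τ ≤ t := by nlinarith
      obtain ⟨f, hf, g, hg, hfg⟩ := ih hkt
      set p := z + (k * τ) • f with hp
      have hpz : dist p z₀ < min ε r / 2 := by
        refine lt_of_le_of_lt ?_ hzt
        rw [add_comm]
        refine (dist_triangle p z z₀).trans (add_le_add_left ?_ _)
        rw [dist_eq_norm, hp, add_sub_cancel_left, norm_smul, Real.norm_of_nonneg (by positivity)]
        exact mul_le_mul hkt (hM f hf) (norm_nonneg _) ht
      obtain ⟨g', hg', hg'min⟩ := hC'cpt.exists_isMinOn ⟨z₀, hz₀'⟩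
        (f := fun c => ‖p - c‖) (by fun_prop)
      have hg'min : ∀ c ∈ C', ‖p - g'‖ ≤ ‖p - c‖ := fun c hc => hg'min hc
      have hg'z : dist g' z₀ < min ε r := by
        have h1 := hg'min z₀ hz₀'
        rw [← dist_eq_norm, ← dist_eq_norm, dist_comm p g'] at h1
        linarith [dist_triangle g' p z₀]
      have hw : p - g' ∈ regularNormalCone C g' := by
        -- Since $g'$ is strictly inside the ball, points of $C$ close to it belong to $C'$.
        refine sub_mem_regularNormalCone_of_nearest (sub_pos.2 hg'z) fun c hc hcg => ?_
        refine hg'min c ⟨hc, ?_⟩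
        rw [Metric.mem_closedBall]
        linarith [dist_triangle c g' z₀, min_le_left ε r]
      obtain ⟨f', hf', hwf'⟩ := hnormal g' hg'.1 (hg'z.trans_le (min_le_right _ _)) _ hw
      have hk1 : (0 : ℝ) < k + 1 := by positivity
      -- The running average of the chosen velocities stays in $F$ by convexity.
      refine ⟨((k : ℝ) / (k + 1)) • f + (1 / ((k : ℝ) + 1)) • f', ?_, g', hg', ?_⟩
      · exact hFcvx hf hf' (by positivity) (by positivity) (by field_simp)
      · have hstep : z + (((k : ℝ) + 1) * τ) • (((k : ℝ) / (k + 1)) • f +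
            (1 / ((k : ℝ) + 1)) • f') - g' = (p - g') + τ • f' := by
          have e1 : ((k : ℝ) + 1) * τ * ((k : ℝ) / (k + 1)) = k * τ := by field_simp
          have e2 : ((k : ℝ) + 1) * τ * (1 / ((k : ℝ) + 1)) = τ := by field_simp
          rw [smul_add, smul_smul, smul_smul, e1, e2, hp]
          abel
        rw [hstep, norm_add_sq_real, real_inner_smul_right, norm_smul, Real.norm_of_nonneg hτ]
        have h1 : ‖p - g'‖ ^ 2 ≤ ‖p - g‖ ^ 2 := by
          have := hg'min g hg
          gcongr
        have h2 : (τ * ‖f'‖) ^ 2 ≤ (M * τ) ^ 2 := by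
          rw [mul_comm M]
          have := hM f' hf'
          gcongr
        nlinarith [mul_nonpos_of_nonneg_of_nonpos hτ hwf']
  obtain ⟨⟨f, g⟩, ⟨hf, hg⟩, hfg⟩ := (hFcpt.prod hC'cpt).exists_isMinOn ⟨(f₀, z), hf₀, hz'⟩
    (f := fun a => ‖z + t • a.1 - a.2‖ ^ 2) (by fun_prop)
  refine ⟨f, hf, ?_⟩
  have hzero : ‖z + t • f - g‖ ^ 2 ≤ 0 := by
    -- With $N+1$ steps of length $t/(N+1)$, the squared errors sum to at most $(Mt)^2/(N+1)$.
    have hlim : Tendsto (fun N : ℕ => (M * t) ^ 2 * (1 / ((N : ℝ) + 1))) atTop (𝓝 0) := by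
      simpa using tendsto_one_div_add_atTop_nhds_zero_nat.const_mul ((M * t) ^ 2)
    refine ge_of_tendsto' hlim fun N => ?_
    have hN : (0 : ℝ) < N + 1 := by positivity
    have e : ((N + 1 : ℕ) : ℝ) * (t / (N + 1)) = t := by push_cast; field_simp
    obtain ⟨f', hf', g', hg', h⟩ := euler (t / (N + 1)) (by positivity) (N + 1) e.le
    rw [e] at h
    refine (hfg (show (f', g') ∈ F ×ˢ C' from ⟨hf', hg'⟩)).trans (h.trans_eq ?_)
    push_cast
    field_simp
  have : z + t • f = g := by
    rw [← sub_eq_zero, ← norm_eq_zero]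
    exact pow_eq_zero_iff (two_ne_zero) |>.1 (le_antisymm hzero (sq_nonneg _))
  rw [this]
  exact hg.1

end Normals

section BallMap

variable {X Y : Type*} [NormedAddCommGroup X] [NormedAddCommGroup Y] [NormedSpace ℝ Y]

theorem ballMap_smul [NormedSpace ℝ X] {κ k : ℝ} (hk : 0 < k) (w : X) :
    ballMap X Y κ (k • w) = k • ballMap X Y κ w := by
  simp only [ballMap, norm_smul, Real.norm_of_nonneg hk.le, smul_smul]
  congr 1
  ring

theorem isCompact_ballMap [ProperSpace Y] (κ : ℝ) (w : X) : IsCompact (ballMap X Y κ w) :=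
  (isCompact_closedBall (0 : Y) 1).smul _

theorem norm_le_of_mem_ballMap {κ : ℝ} (hκ : 0 ≤ κ) {w : X} {z : Y} (hz : z ∈ ballMap X Y κ w) :
    ‖z‖ ≤ κ * ‖w‖ := by
  obtain ⟨b, hb, rfl⟩ := hz
  rw [mem_closedBall_zero_iff] at hb
  simp only [norm_smul]
  rw [Real.norm_of_nonneg (by positivity)]
  exact mul_le_of_le_one_right (by positivity) hb

end BallMap

/-! ### Necessity: bounds on the coderivative -/

section Coderivatives

variable {X Y : Type*} [NormedAddCommGroup X] [InnerProductSpace ℝ X]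
  [NormedAddCommGroup Y] [InnerProductSpace ℝ Y]

theorem zero_mem_coderivative {S : X → Set Y} {x₀ : X} {y₀ : Y} (h : y₀ ∈ S x₀) :
    (0 : X) ∈ coderivative S x₀ y₀ 0 := by
  have := zero_mem_limitingNormalCone (C := graph S) (z₀ := WithLp.toLp 2 (x₀, y₀)) h
  change WithLp.toLp 2 ((0 : X), -(0 : Y)) ∈ limitingNormalCone (graph S) _
  rw [neg_zero]
  exact this

theorem smul_mem_coderivative {S : X → Set Y} {x₀ : X} {y₀ : Y} {u : Y} {v : X}
    (hv : v ∈ coderivative S x₀ y₀ u) {c : ℝ} (hc : 0 < c) :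
    c • v ∈ coderivative S x₀ y₀ (c • u) := by
  have h := smul_mem_limitingNormalCone (show WithLp.toLp 2 (v, -u) ∈ limitingNormalCone (graph S) _ from hv) hc
  rw [← WithLp.toLp_smul, Prod.smul_mk, smul_neg] at h
  exact h

theorem mem_coderivative_of_tendsto {S : X → Set Y} {x₀ : X} {y₀ : Y} {u : ℕ → Y} {v : ℕ → X}
    {u' : Y} {v' : X} (h : ∀ i, v i ∈ coderivative S x₀ y₀ (u i))
    (hu : Tendsto u atTop (𝓝 u')) (hv : Tendsto v atTop (𝓝 v')) :
    v' ∈ coderivative S x₀ y₀ u' :=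
  (isClosed_limitingNormalCone _ _).mem_of_tendsto
    (((WithLp.prod_continuous_toLp 2 X Y).tendsto _).comp (hv.prodMk_nhds hu.neg))
    (Eventually.of_forall h)

/-- A pseudo strict derivative `H` controls the values of regular normals near the base point. -/
theorem exists_inner_le_of_regularNormal {S H : X → Set Y} {x : X} {y : Y} {U : Set X} {V : Set Y}
    {δ : ℝ} (hU : U ∈ 𝓝 x) (hV : V ∈ 𝓝 y)
    (hS : ∀ a ∈ U, ∀ a' ∈ U, S a ∩ V ⊆ S a' + enlarge H δ (a - a'))
    (hy : y ∈ S x) (hH : ∀ k : ℝ, 0 < k → ∀ w : X, H (k • w) = k • H w)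
    {q : X} (hb : Bornology.IsBounded (H q)) {w : WithLp 2 (X × Y)}
    (hw : w ∈ regularNormalCone (graph S) (WithLp.toLp 2 (x, y))) {η : ℝ} (hη : 0 < η) :
    ∃ h ∈ H q, -inner ℝ w.snd h ≤ inner ℝ w.fst q + |δ| * ‖q‖ * ‖w.snd‖ + η := by
  obtain ⟨R, hR⟩ := hb.exists_norm_le
  set M := ‖q‖ + (|R| + |δ| * ‖q‖) + 1 with hM
  have hMpos : 0 < M := by positivity
  have h1 := hw (η / M) (by positivity)
  rw [Filter.Eventually, Metric.mem_nhdsWithin_iff] at h1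
  obtain ⟨r, hr, hball⟩ := h1
  have hlim : Tendsto (fun t : ℝ => x - t • q) (𝓝[>] 0) (𝓝 x) := by
    have : Continuous fun t : ℝ => x - t • q := by fun_prop
    have h := this.tendsto 0
    rw [zero_smul, sub_zero] at h
    exact h.mono_left nhdsWithin_le_nhds
  have hsmall : ∀ᶠ t : ℝ in 𝓝[>] 0, t < r / M :=
    mem_nhdsWithin_of_mem_nhds (Iio_mem_nhds (by positivity))
  -- A small step from $x$ to $x-tq$ is answered by $y'=y-tc$ with $c=h+\delta\|q\|b$, $h\in H(q)$,
  -- $\|b\|\le1$. The norm of $(q,c)$ is below $M$ independently of $t$, so the normal inequality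
  -- can be divided by $t$.
  obtain ⟨t, htU, htr, ht⟩ :=
    ((hlim.eventually hU).and (hsmall.and self_mem_nhdsWithin)).exists
  have ht : 0 < t := ht
  obtain ⟨y', hy', e, ⟨h', hh', b', ⟨b, hb, hb'⟩, he⟩, hye⟩ :=
    hS x (mem_of_mem_nhds hU) (x - t • q) htU ⟨hy, mem_of_mem_nhds hV⟩
  rw [sub_sub_cancel] at hh' hb'
  rw [hH t ht q] at hh'
  obtain ⟨h, hh, rfl⟩ := hh'
  simp only at he hye hb'
  rw [mem_closedBall_zero_iff] at hb
  rw [norm_smul, Real.norm_of_nonneg ht.le] at hb'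
  have hyy : y' - y = -(t • (h + (δ * ‖q‖) • b)) := by
    rw [← hye, ← he, ← hb', smul_add, smul_smul]
    rw [show δ * (t * ‖q‖) = t * (δ * ‖q‖) by ring]
    abel
  set c := h + (δ * ‖q‖) • b with hc
  have hdb : ‖(δ * ‖q‖) • b‖ ≤ |δ| * ‖q‖ := by
    rw [norm_smul, norm_mul, Real.norm_eq_abs, norm_norm]
    exact mul_le_of_le_one_right (by positivity) hb
  have hcn : ‖c‖ ≤ |R| + |δ| * ‖q‖ :=
    (norm_add_le _ _).trans (add_le_add ((hR h hh).trans (le_abs_self R)) hdb)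
  have hdiff : WithLp.toLp 2 (x - t • q, y') - WithLp.toLp 2 (x, y) =
      -(t • WithLp.toLp 2 (q, c)) := by
    rw [← WithLp.toLp_sub, ← WithLp.toLp_smul, ← WithLp.toLp_neg, Prod.mk_sub_mk, hyy]
    simp
  have hqc : ‖WithLp.toLp 2 (q, c)‖ < M := by
    have h2 := WithLp.prod_norm_sq_eq_of_L2 (WithLp.toLp 2 (q, c))
    simp only [WithLp.toLp_fst, WithLp.toLp_snd] at h2
    have h3 : ‖WithLp.toLp 2 (q, c)‖ ≤ ‖q‖ + ‖c‖ := by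
      refine le_of_sq_le_sq ?_ (by positivity)
      nlinarith [mul_nonneg (norm_nonneg q) (norm_nonneg c)]
    linarith
  have hn : ‖WithLp.toLp 2 (x - t • q, y') - WithLp.toLp 2 (x, y)‖ =
      t * ‖WithLp.toLp 2 (q, c)‖ := by
    rw [hdiff, norm_neg, norm_smul, Real.norm_of_nonneg ht.le]
  have key := hball (a := WithLp.toLp 2 (x - t • q, y')) ⟨by
    rw [Metric.mem_ball, dist_eq_norm, hn]
    calc t * ‖WithLp.toLp 2 (q, c)‖ ≤ t * M := by gcongr
      _ < r / M * M := by gcongr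
      _ = r := by field_simp, hy'⟩
  simp only [Set.mem_ofPred_eq] at key
  rw [hn, hdiff, inner_neg_right, real_inner_smul_right] at key
  have key2 : -inner ℝ w (WithLp.toLp 2 (q, c)) ≤ η := by
    have h4 : η / M * ‖WithLp.toLp 2 (q, c)‖ ≤ η := by
      calc η / M * ‖WithLp.toLp 2 (q, c)‖ ≤ η / M * M := by gcongr
        _ = η := by field_simp
    have h5 : t * -inner ℝ w (WithLp.toLp 2 (q, c)) ≤ t * η := by nlinarith
    exact le_of_mul_le_mul_left h5 ht
  rw [WithLp.prod_inner_apply] at key2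
  simp only [WithLp.ofLp_fst, WithLp.ofLp_snd] at key2
  rw [hc, inner_add_right] at key2
  have h6 : inner ℝ w.snd ((δ * ‖q‖) • b) ≤ |δ| * ‖q‖ * ‖w.snd‖ := by
    have h7 := abs_real_inner_le_norm w.snd ((δ * ‖q‖) • b)
    have h8 : ‖w.snd‖ * ‖(δ * ‖q‖) • b‖ ≤ ‖w.snd‖ * (|δ| * ‖q‖) := by gcongr
    linarith [le_abs_self (inner ℝ w.snd ((δ * ‖q‖) • b))]
  exact ⟨h, hh, by linarith⟩

/-- Pseudo strict `H`-differentiability bounds the coderivative from below. -/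
theorem PseudoStrictDiffAt.exists_inner_le_of_mem_coderivative {S H : X → Set Y} {x₀ : X} {y₀ : Y}
    (hS : PseudoStrictDiffAt S H x₀ y₀) (hH : ∀ k : ℝ, 0 < k → ∀ w : X, H (k • w) = k • H w)
    {q : X} (hcpt : IsCompact (H q)) {u : Y} {v : X} (hv : v ∈ coderivative S x₀ y₀ u) :
    ∃ h ∈ H q, inner ℝ u h ≤ inner ℝ v q := by
  have approx : ∀ η : ℝ, 0 < η → ∃ h ∈ H q, inner ℝ u h ≤ inner ℝ v q + η := by
    intro η hη
    obtain ⟨R, hR⟩ := hcpt.isBounded.exists_norm_le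
    obtain ⟨z, w, hz, hzt, hw, hwt⟩ := hv
    -- This makes the limiting error $\delta\|q\|\|u\|$ at most $\eta/4$.
    set δ := η / 4 / (‖q‖ * ‖u‖ + 1) with hδ
    have hδpos : 0 < δ := by positivity
    obtain ⟨U, hU, V, hV, hUV⟩ := hS δ hδpos
    have hfst : Tendsto (fun i => (z i).fst) atTop (𝓝 x₀) :=
      ((WithLp.continuous_fst 2 X Y).tendsto _).comp hzt
    have hsnd : Tendsto (fun i => (z i).snd) atTop (𝓝 y₀) :=
      ((WithLp.continuous_snd 2 X Y).tendsto _).comp hzt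
    have hwf : Tendsto (fun i => (w i).fst) atTop (𝓝 v) :=
      ((WithLp.continuous_fst 2 X Y).tendsto _).comp hwt
    have hws : Tendsto (fun i => (w i).snd) atTop (𝓝 (-u)) :=
      ((WithLp.continuous_snd 2 X Y).tendsto _).comp hwt
    have e1 : ∀ᶠ i in atTop, U ∈ 𝓝 (z i).fst := hfst.eventually (eventually_mem_nhds_iff.2 hU)
    have e2 : ∀ᶠ i in atTop, V ∈ 𝓝 (z i).snd := hsnd.eventually (eventually_mem_nhds_iff.2 hV)
    have e3 : ∀ᶠ i in atTop, inner ℝ (w i).fst q + |δ| * ‖q‖ * ‖(w i).snd‖ + η / 4 +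
        ‖(w i).snd + u‖ * |R| < inner ℝ v q + η := by
      have hl : Tendsto (fun i => inner ℝ (w i).fst q + |δ| * ‖q‖ * ‖(w i).snd‖ + η / 4 +
          ‖(w i).snd + u‖ * |R|) atTop
          (𝓝 (inner ℝ v q + |δ| * ‖q‖ * ‖-u‖ + η / 4 + ‖-u + u‖ * |R|)) :=
        (((hwf.inner tendsto_const_nhds).add (hws.norm.const_mul _)).add_const _).add
          ((hws.add_const u).norm.mul_const _)
      refine hl.eventually_lt_const ?_
      rw [norm_neg, neg_add_cancel, norm_zero, zero_mul, abs_of_pos hδpos, hδ]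
      have : η / 4 / (‖q‖ * ‖u‖ + 1) * ‖q‖ * ‖u‖ ≤ η / 4 := by
        rw [mul_assoc, div_mul_eq_mul_div]
        exact div_le_of_le_mul₀ (by positivity) (by positivity) (by nlinarith)
      linarith
    obtain ⟨i, h1, h2, h3⟩ := (e1.and (e2.and e3)).exists
    obtain ⟨h, hh, hle⟩ := exists_inner_le_of_regularNormal h1 h2 hUV (hz i) hH hcpt.isBounded
      (hw i) (η := η / 4) (by positivity)
    refine ⟨h, hh, ?_⟩
    have h4 : inner ℝ ((w i).snd + u) h ≤ ‖(w i).snd + u‖ * |R| := by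
      refine (real_inner_le_norm _ _).trans ?_
      have := (hR h hh).trans (le_abs_self R)
      gcongr
    rw [inner_add_left] at h4
    linarith
  obtain ⟨h₁, hh₁, -⟩ := approx 1 one_pos
  obtain ⟨h, hh, hmin⟩ := hcpt.exists_isMinOn ⟨h₁, hh₁⟩ (f := fun a => inner ℝ u a) (by fun_prop)
  refine ⟨h, hh, le_of_forall_pos_le_add fun η hη => ?_⟩
  obtain ⟨h', hh', hle⟩ := approx η hη
  exact (hmin hh').trans hle

/-- Testing with $q=-v$ gives $\langle u,h\rangle\le-\|v\|^2$ for some $\|h\|\le\kappa\|v\|$. In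
particular $D^*S(0)$ contains no nonzero vector. -/
theorem AubinAt.exists_norm_le_of_mem_coderivative [ProperSpace Y] {S : X → Set Y} {x₀ : X}
    {y₀ : Y} (hS : AubinAt S x₀ y₀) :
    ∃ κ : ℝ, ∀ u, ∀ v ∈ coderivative S x₀ y₀ u, ‖v‖ ≤ κ * ‖u‖ := by
  obtain ⟨κ, hκ, hS⟩ := hS
  refine ⟨κ, fun u v hv => ?_⟩
  obtain ⟨h, hh, hle⟩ := hS.exists_inner_le_of_mem_coderivative
    (fun k hk w => ballMap_smul hk w) (q := -v) (isCompact_ballMap κ _) hv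
  have hn := norm_le_of_mem_ballMap hκ hh
  rw [norm_neg] at hn
  rw [inner_neg_right, real_inner_self_eq_norm_sq] at hle
  have h1 := (abs_le.1 (abs_real_inner_le_norm u h)).1
  have h2 : ‖u‖ * ‖h‖ ≤ ‖u‖ * (κ * ‖v‖) := by gcongr
  rcases (norm_nonneg v).eq_or_lt with h0 | h0
  · rw [← h0]; positivity
  · nlinarith

end Coderivatives

/-! ### Sufficiency: from the coderivative to the graph -/

section Sufficiency

variable {X Y : Type*} [NormedAddCommGroup X] [InnerProductSpace ℝ X]
  [NormedAddCommGroup Y] [InnerProductSpace ℝ Y]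

/-- A bound on the limiting coderivative extends, up to `δ`, to all regular normals nearby. -/
theorem exists_inner_nonneg_of_regularNormal [FiniteDimensional ℝ X] [FiniteDimensional ℝ Y]
    {S : X → Set Y} {x₀ : X} {y₀ : Y} {K : Set Y} {q : X}
    (hy₀ : y₀ ∈ S x₀) (hzero : ∀ v ∈ coderivative S x₀ y₀ 0, v = 0)
    (hK : ∀ u, ∀ v ∈ coderivative S x₀ y₀ u, ∃ h ∈ K, inner ℝ u h ≤ inner ℝ v q)
    {δ : ℝ} (hδ : 0 < δ) :
    ∃ r : ℝ, 0 < r ∧ ∀ z ∈ graph S, dist z (WithLp.toLp 2 (x₀, y₀)) < r →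
      ∀ w ∈ regularNormalCone (graph S) z, ∃ h ∈ K + Metric.closedBall (0 : Y) δ,
        0 ≤ inner ℝ w.fst q + inner ℝ w.snd h := by
  by_contra! hcon
  choose z hz hzd w hw hlt using fun i : ℕ => hcon (1 / ((i : ℝ) + 1)) (by positivity)
  obtain ⟨k₀, hk₀, -⟩ := hK 0 0 (zero_mem_coderivative hy₀)
  have hmemK : ∀ k ∈ K, k ∈ K + Metric.closedBall (0 : Y) δ := fun k hk =>
    ⟨k, hk, 0, Metric.mem_closedBall_self hδ.le, add_zero k⟩
  have hw0 : ∀ i, 0 < ‖w i‖ := by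
    intro i
    rw [norm_pos_iff]
    intro h
    have := hlt i k₀ (hmemK k₀ hk₀)
    rw [h] at this
    simp at this
  set n : ℕ → WithLp 2 (X × Y) := fun i => ‖w i‖⁻¹ • w i with hn
  obtain ⟨a, ha, φ, hφ, hlim⟩ := (isCompact_sphere (0 : WithLp 2 (X × Y)) 1).tendsto_subseq
    (x := n) (fun i => by
      rw [mem_sphere_zero_iff_norm, hn, norm_smul, norm_inv, norm_norm, inv_mul_cancel₀ (hw0 i).ne'])
  rw [mem_sphere_zero_iff_norm] at ha
  have hzlim : Tendsto z atTop (𝓝 (WithLp.toLp 2 (x₀, y₀))) := by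
    rw [tendsto_iff_dist_tendsto_zero]
    exact squeeze_zero (fun _ => dist_nonneg) (fun i => (hzd i).le)
      tendsto_one_div_add_atTop_nhds_zero_nat
  have hacod : a.fst ∈ coderivative S x₀ y₀ (-a.snd) := by
    change WithLp.toLp 2 (a.fst, - -a.snd) ∈ limitingNormalCone (graph S) _
    rw [neg_neg]
    exact ⟨z ∘ φ, n ∘ φ, fun i => hz _, hzlim.comp hφ.tendsto_atTop,
      fun i => smul_mem_regularNormalCone (hw _) (inv_pos.2 (hw0 _)), hlim⟩
  have hle : ∀ h ∈ K + Metric.closedBall (0 : Y) δ, inner ℝ a.fst q + inner ℝ a.snd h ≤ 0 := by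
    intro h hh
    have hf : Tendsto (fun i => (n (φ i)).fst) atTop (𝓝 a.fst) :=
      ((WithLp.continuous_fst 2 X Y).tendsto _).comp hlim
    have hs : Tendsto (fun i => (n (φ i)).snd) atTop (𝓝 a.snd) :=
      ((WithLp.continuous_snd 2 X Y).tendsto _).comp hlim
    refine le_of_tendsto' ((hf.inner tendsto_const_nhds).add (hs.inner tendsto_const_nhds))
      fun i => ?_
    simp only [hn, WithLp.smul_fst, WithLp.smul_snd, real_inner_smul_left]
    rw [← mul_add]
    exact mul_nonpos_of_nonneg_of_nonpos (by positivity) (hlt _ h hh).le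
  obtain ⟨k, hk, hkle⟩ := hK _ _ hacod
  rw [inner_neg_left] at hkle
  -- Otherwise `hzero` would force the unit vector $a$ to vanish.
  have hsnd : a.snd ≠ 0 := by
    intro h
    rw [h, neg_zero] at hacod
    have h1 := WithLp.prod_norm_sq_eq_of_L2 a
    rw [hzero _ hacod, h, ha] at h1
    simp at h1
  have hpos : 0 < ‖a.snd‖ := norm_pos_iff.2 hsnd
  -- The $\delta$-ball allows a shift along `a.snd` that raises a nonnegative value by $\delta$
  -- times its norm.
  have := hle (k + (δ / ‖a.snd‖) • a.snd) ⟨k, hk, _, by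
    rw [mem_closedBall_zero_iff, norm_smul, Real.norm_of_nonneg (by positivity),
      div_mul_cancel₀ _ hpos.ne'], rfl⟩
  rw [inner_add_right, real_inner_smul_right, real_inner_self_eq_norm_sq] at this
  have h2 : 0 < δ / ‖a.snd‖ * ‖a.snd‖ ^ 2 := by positivity
  linarith

/-- A lower bound of the coderivative in the direction `q` yields the pseudo strict
differentiability estimate along `q`. -/
theorem exists_sub_smul_mem_of_coderivative [FiniteDimensional ℝ X] [FiniteDimensional ℝ Y]
    {S : X → Set Y} {x₀ : X} {y₀ : Y} {K : Set Y} {q : X} (hy₀ : y₀ ∈ S x₀)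
    (hclosed : LocallyClosedAt S x₀ y₀) (hzero : ∀ v ∈ coderivative S x₀ y₀ 0, v = 0)
    (hKcvx : Convex ℝ K) (hKcpt : IsCompact K)
    (hK : ∀ u, ∀ v ∈ coderivative S x₀ y₀ u, ∃ h ∈ K, inner ℝ u h ≤ inner ℝ v q)
    {δ : ℝ} (hδ : 0 < δ) :
    ∃ ρ : ℝ, 0 < ρ ∧ ∀ x y t, dist x x₀ < ρ → dist y y₀ < ρ → 0 ≤ t → t < ρ → y ∈ S x →
      ∃ h ∈ K + Metric.closedBall (0 : Y) δ, y - t • h ∈ S (x - t • q) := by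
  obtain ⟨r, hr, hnormal⟩ := exists_inner_nonneg_of_regularNormal hy₀ hzero hK hδ
  obtain ⟨ε, hε, hcl⟩ := hclosed
  set Kδ := K + Metric.closedBall (0 : Y) δ with hKδ
  have hKδcvx : Convex ℝ Kδ := hKcvx.add (convex_closedBall _ _)
  have hKδcpt : IsCompact Kδ := hKcpt.add (isCompact_closedBall _ _)
  set F : Set (WithLp 2 (X × Y)) := (fun h => WithLp.toLp 2 (-q, -h)) '' Kδ with hF
  have hFcpt : IsCompact F := hKδcpt.image
    ((WithLp.prod_continuous_toLp 2 X Y).comp (continuous_const.prodMk continuous_neg))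
  have hFcvx : Convex ℝ F := by
    rintro _ ⟨a, ha, rfl⟩ _ ⟨b, hb, rfl⟩ s t hs ht hst
    refine ⟨s • a + t • b, hKδcvx ha hb hs ht hst, ?_⟩
    rw [← WithLp.toLp_smul, ← WithLp.toLp_smul, ← WithLp.toLp_add, Prod.smul_mk, Prod.smul_mk,
      Prod.mk_add_mk, ← add_smul, hst, one_smul, smul_neg, smul_neg, ← neg_add]
  obtain ⟨M, hM⟩ := hFcpt.isBounded.exists_norm_le
  obtain ⟨ρ, hρ, hmain⟩ := exists_add_smul_mem_of_regularNormals hε hr hcl hy₀ hFcvx hFcpt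
    (M := |M|) (fun f hf => (hM f hf).trans (le_abs_self M)) (fun z hz hzr w hw => by
      obtain ⟨h, hh, hle⟩ := hnormal z hz hzr w hw
      refine ⟨_, ⟨h, hh, rfl⟩, ?_⟩
      rw [WithLp.prod_inner_apply]
      simp only [WithLp.ofLp_fst, WithLp.ofLp_snd, inner_neg_right]
      linarith)
  -- The distances of $x$ and $y$ and the travel $t|M|$ together cost less than $\rho$.
  refine ⟨ρ / (2 + |M|), by positivity, fun x y t hx hy ht0 ht hxy => ?_⟩
  have hd : dist (WithLp.toLp 2 (x, y)) (WithLp.toLp 2 (x₀, y₀)) ≤ dist x x₀ + dist y y₀ := by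
    rw [WithLp.prod_dist_eq_of_L2]
    simp only [WithLp.toLp_fst, WithLp.toLp_snd]
    refine Real.sqrt_le_iff.2 ⟨by positivity, ?_⟩
    nlinarith [mul_nonneg (dist_nonneg (x := x) (y := x₀)) (dist_nonneg (x := y) (y := y₀))]
  obtain ⟨_, ⟨h, hh, rfl⟩, hmem⟩ := hmain (WithLp.toLp 2 (x, y)) hxy t ht0 (by
    have h1 : t * |M| ≤ ρ / (2 + |M|) * |M| := by gcongr
    have h2 : ρ / (2 + |M|) + ρ / (2 + |M|) + ρ / (2 + |M|) * |M| = ρ := by field_simp; ring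
    linarith)
  refine ⟨h, hh, ?_⟩
  have : (y + t • -h) ∈ S (x + t • -q) := hmem
  rwa [smul_neg, smul_neg, ← sub_eq_add_neg, ← sub_eq_add_neg] at this

end Sufficiency

/-! ### Prefans prescribed on a single ray -/

section RayFan

variable {X Y : Type*} [NormedAddCommGroup X] [NormedSpace ℝ X]
  [NormedAddCommGroup Y] [NormedSpace ℝ Y]

open Classical in
/-- The map with value `t • K` at `t • q` for `t > 0`, equal to `ballMap X Y κ` off the open ray
spanned by `q`. -/
noncomputable def rayFan (κ : ℝ) (q : X) (K : Set Y) : X → Set Y :=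
  fun w => if ∃ t : ℝ, 0 < t ∧ w = t • q then (‖w‖ / ‖q‖) • K else ballMap X Y κ w

variable {κ : ℝ} {q : X} {K : Set Y}

theorem rayFan_smul_self (hq : q ≠ 0) {t : ℝ} (ht : 0 < t) : rayFan κ q K (t • q) = t • K := by
  have hq' : ‖q‖ ≠ 0 := norm_ne_zero_iff.2 hq
  rw [rayFan, if_pos ⟨t, ht, rfl⟩, norm_smul, Real.norm_of_nonneg ht.le, mul_div_assoc,
    div_self hq', mul_one]

theorem rayFan_of_not {w : X} (hw : ¬ ∃ t : ℝ, 0 < t ∧ w = t • q) :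
    rayFan κ q K w = ballMap X Y κ w := if_neg hw

theorem rayFan_smul (hq : q ≠ 0) {k : ℝ} (hk : 0 < k) (w : X) :
    rayFan κ q K (k • w) = k • rayFan κ q K w := by
  by_cases h : ∃ t : ℝ, 0 < t ∧ w = t • q
  · obtain ⟨t, ht, rfl⟩ := h
    rw [smul_smul, rayFan_smul_self hq ht, rayFan_smul_self hq (mul_pos hk ht), smul_smul]
  · have h' : ¬ ∃ t : ℝ, 0 < t ∧ k • w = t • q := by
      rintro ⟨t, ht, hkw⟩
      exact h ⟨k⁻¹ * t, by positivity, by rw [mul_smul, ← hkw, inv_smul_smul₀ hk.ne']⟩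
    rw [rayFan_of_not h, rayFan_of_not h', ballMap_smul hk]

theorem isPrefan_rayFan [ProperSpace Y] (hκ : 0 ≤ κ) (hq : q ≠ 0) (hKne : K.Nonempty)
    (hKcvx : Convex ℝ K) (hKcpt : IsCompact K) : IsPrefan (rayFan κ q K) where
  nonempty p := by
    by_cases h : ∃ t : ℝ, 0 < t ∧ p = t • q
    · rw [rayFan, if_pos h]; exact hKne.smul_set
    · rw [rayFan_of_not h]
      exact (Metric.nonempty_closedBall.2 zero_le_one).smul_set
  convex p := by
    by_cases h : ∃ t : ℝ, 0 < t ∧ p = t • q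
    · rw [rayFan, if_pos h]; exact hKcvx.smul _
    · rw [rayFan_of_not h]; exact (convex_closedBall _ _).smul _
  isCompact p := by
    by_cases h : ∃ t : ℝ, 0 < t ∧ p = t • q
    · rw [rayFan, if_pos h]; exact hKcpt.smul _
    · rw [rayFan_of_not h]; exact isCompact_ballMap κ p
  posHomogeneous := by
    refine ⟨?_, fun k hk w => rayFan_smul hq hk w⟩
    have h0 : ¬ ∃ t : ℝ, 0 < t ∧ (0 : X) = t • q := by
      rintro ⟨t, ht, h⟩
      exact (smul_ne_zero ht.ne' hq) h.symm
    have e : rayFan κ q K 0 = {0} := by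
      rw [rayFan_of_not h0, ballMap, norm_zero, mul_zero,
        Set.zero_smul_set (Metric.nonempty_closedBall.2 zero_le_one)]
      rfl
    rw [e]
    exact ⟨rfl, fun k _ z hz => by rw [Set.mem_singleton_iff.1 hz, smul_zero]; rfl⟩
  outerNorm_lt_top := by
    obtain ⟨R, hR⟩ := hKcpt.isBounded.exists_norm_le
    have hqpos : 0 < ‖q‖ := norm_pos_iff.2 hq
    refine lt_of_le_of_lt (b := ENNReal.ofReal (κ + |R| / ‖q‖)) ?_ ENNReal.ofReal_lt_top
    refine iSup₂_le fun w hw => iSup₂_le fun z hz => ?_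
    rw [← ofReal_norm]
    refine ENNReal.ofReal_le_ofReal ?_
    by_cases h : ∃ t : ℝ, 0 < t ∧ w = t • q
    · rw [rayFan, if_pos h] at hz
      obtain ⟨b, hb, rfl⟩ := hz
      simp only [norm_smul, norm_div, norm_norm]
      calc ‖w‖ / ‖q‖ * ‖b‖ ≤ 1 / ‖q‖ * |R| := by
            have := (hR b hb).trans (le_abs_self R)
            gcongr
        _ = |R| / ‖q‖ := by ring
        _ ≤ κ + |R| / ‖q‖ := by linarith
    · rw [rayFan_of_not h] at hz
      have h1 := norm_le_of_mem_ballMap hκ hz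
      have h2 : κ * ‖w‖ ≤ κ := mul_le_of_le_one_right hκ hw
      have : 0 ≤ |R| / ‖q‖ := by positivity
      linarith

end RayFan

/-! ### Separation and uniqueness -/

section Uniqueness

variable {X Y : Type*} [NormedAddCommGroup X] [InnerProductSpace ℝ X] [FiniteDimensional ℝ X]
  [NormedAddCommGroup Y] [InnerProductSpace ℝ Y] [FiniteDimensional ℝ Y]

/-- The defining inclusion concerns one displacement $x-x'$ at a time: on the ray of $q$ the
directional estimate applies, off it the Aubin estimate. -/
theorem pseudoStrictDiffAt_rayFan {S : X → Set Y} {x₀ : X} {y₀ : Y} {κ : ℝ} {K : Set Y} {q : X}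
    (hq : q ≠ 0) (hy₀ : y₀ ∈ S x₀) (hclosed : LocallyClosedAt S x₀ y₀)
    (hκ : PseudoStrictDiffAt S (ballMap X Y κ) x₀ y₀)
    (hzero : ∀ v ∈ coderivative S x₀ y₀ 0, v = 0) (hKcvx : Convex ℝ K) (hKcpt : IsCompact K)
    (hK : ∀ u, ∀ v ∈ coderivative S x₀ y₀ u, ∃ h ∈ K, inner ℝ u h ≤ inner ℝ v q) :
    PseudoStrictDiffAt S (rayFan κ q K) x₀ y₀ := by
  intro δ hδ
  have hqpos : 0 < ‖q‖ := norm_pos_iff.2 hq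
  obtain ⟨U, hU, V, hV, hUV⟩ := hκ δ hδ
  obtain ⟨ρ, hρ, hmain⟩ := exists_sub_smul_mem_of_coderivative hy₀ hclosed hzero hKcvx hKcpt hK
    (mul_pos hδ hqpos)
  -- If $x-x'=tq$, then $t\|q\|<2\sigma\le\rho\|q\|$, hence $t<\rho$.
  set σ := min ρ (ρ * ‖q‖ / 2) with hσ
  have hσpos : 0 < σ := by positivity
  refine ⟨U ∩ Metric.ball x₀ σ, inter_mem hU (Metric.ball_mem_nhds _ hσpos),
    V ∩ Metric.ball y₀ σ, inter_mem hV (Metric.ball_mem_nhds _ hσpos), ?_⟩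
  rintro x ⟨hxU, hxσ⟩ x' ⟨hxU', hxσ'⟩ y ⟨hy, hyV, hyσ⟩
  by_cases h : ∃ t : ℝ, 0 < t ∧ x - x' = t • q
  · obtain ⟨t, ht, hxt⟩ := h
    have htρ : t < ρ := by
      have h1 : t * ‖q‖ = dist x x' := by
        rw [dist_eq_norm, hxt, norm_smul, Real.norm_of_nonneg ht.le]
      have h2 : dist x x' < σ + σ :=
        (dist_triangle_right x x' x₀).trans_lt (add_lt_add hxσ hxσ')
      have h3 : σ ≤ ρ * ‖q‖ / 2 := min_le_right _ _
      exact lt_of_mul_lt_mul_right (by linarith) hqpos.le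
    obtain ⟨h, ⟨k, hk, b, hb, rfl⟩, hmem⟩ := hmain x y t (hxσ.trans_le (min_le_left _ _))
      (hyσ.trans_le (min_le_left _ _)) ht.le htρ hy
    rw [← hxt, sub_sub_cancel] at hmem
    refine ⟨_, hmem, t • (k + b), ?_, sub_add_cancel _ _⟩
    rw [hxt, smul_add]
    refine Set.add_mem_add ?_ ?_
    · rw [rayFan_smul_self hq ht]
      exact Set.smul_mem_smul_set hk
    · rw [ballMap, norm_smul, Real.norm_of_nonneg ht.le]
      refine ⟨(δ * ‖q‖)⁻¹ • b, ?_, ?_⟩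
      · rw [mem_closedBall_zero_iff] at hb ⊢
        rw [norm_smul, norm_inv, Real.norm_of_nonneg (by positivity)]
        exact inv_mul_le_one_of_le₀ hb (by positivity)
      · simp only [smul_smul]
        congr 1
        field_simp
  · have := hUV x hxU x' hxU' ⟨hy, hyV⟩
    rwa [enlarge, ← rayFan_of_not (K := K) h] at this

/-- A strict lower bound `c` of `⟪·, q⟫` on `D*S(x₀ | y₀)(u₀)` is realised by a compact convex
set that satisfies the coderivative criterion in the direction `q`. -/
theorem exists_compact_convex_of_lt_coderivative {S : X → Set Y} {x₀ : X} {y₀ : Y} {κ c : ℝ}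
    (hκ : ∀ u, ∀ v ∈ coderivative S x₀ y₀ u, ‖v‖ ≤ κ * ‖u‖) {q : X} {u₀ : Y} (hu₀ : u₀ ≠ 0)
    (hc : ∀ v ∈ coderivative S x₀ y₀ u₀, c < inner ℝ v q) :
    ∃ K : Set Y, K.Nonempty ∧ Convex ℝ K ∧ IsCompact K ∧ (∀ h ∈ K, c ≤ inner ℝ u₀ h) ∧
      ∀ u, ∀ v ∈ coderivative S x₀ y₀ u, ∃ h ∈ K, inner ℝ u h ≤ inner ℝ v q := by
  have hu₀pos : 0 < ‖u₀‖ := norm_pos_iff.2 hu₀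
  set e := (c / ‖u₀‖ ^ 2) • u₀ with he
  have he' : inner ℝ u₀ e = c := by
    rw [he, real_inner_smul_right, real_inner_self_eq_norm_sq]
    field_simp
  set K : ℝ → Set Y := fun R => {h | c ≤ inner ℝ u₀ h} ∩ Metric.closedBall 0 R with hKdef
  have hKcvx : ∀ R, Convex ℝ (K R) := fun R =>
    (convex_halfSpace_ge (innerₛₗ ℝ u₀).isLinear c).inter (convex_closedBall _ _)
  have hKcpt : ∀ R, IsCompact (K R) := fun R =>
    (isCompact_closedBall _ _).inter_left (isClosed_le continuous_const (by fun_prop))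
  have heK : ∀ R, ‖e‖ ≤ R → e ∈ K R := fun R hR =>
    ⟨he'.ge, mem_closedBall_zero_iff.2 hR⟩
  suffices h : ∃ N : ℕ, ∀ u, ‖u‖ = ‖u₀‖ → ∀ v ∈ coderivative S x₀ y₀ u,
      ∃ h ∈ K (‖e‖ + N), inner ℝ u h ≤ inner ℝ v q by
    obtain ⟨N, hN⟩ := h
    have heN : e ∈ K (‖e‖ + N) := heK _ (by simp)
    refine ⟨K (‖e‖ + N), ⟨e, heN⟩, hKcvx _, hKcpt _, fun h hh => hh.1, fun u v hv => ?_⟩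
    rcases eq_or_ne u 0 with rfl | hu
    · have : v = 0 := by simpa using hκ _ v hv
      exact ⟨e, heN, by simp [this]⟩
    · have hupos : 0 < ‖u‖ := norm_pos_iff.2 hu
      have ha : 0 < ‖u₀‖ / ‖u‖ := by positivity
      obtain ⟨h, hh, hle⟩ := hN ((‖u₀‖ / ‖u‖) • u)
        (by rw [norm_smul, Real.norm_of_nonneg ha.le]; field_simp) _ (smul_mem_coderivative hv ha)
      rw [real_inner_smul_left, real_inner_smul_left] at hle
      exact ⟨h, hh, le_of_mul_le_mul_left hle ha⟩
  -- If no radius suffices, a limit pair $(a,b)$ has $\langle b,q\rangle\le\langle a,h\rangle$ on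
  -- the whole half-space $\langle u_0,h\rangle\ge c$. For $a=u_0$ the point $e$ contradicts the
  -- strictness of $c$. For $a\ne u_0$ of equal norm, $\langle a,\cdot\rangle$ is unbounded below
  -- along $e+s(u_0-a)$, which stays in the half-space.
  by_contra! hcon
  choose u hu v hv hlt using hcon
  have huv : ∀ i, (u i, v i) ∈ Metric.sphere (0 : Y) ‖u₀‖ ×ˢ
      Metric.closedBall (0 : X) (κ * ‖u₀‖) := fun i => by
    refine ⟨by simpa using hu i, ?_⟩
    rw [mem_closedBall_zero_iff]
    simpa [hu i] using hκ _ _ (hv i)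
  obtain ⟨⟨a, b⟩, ⟨ha, -⟩, φ, hφ, hlim⟩ := ((isCompact_sphere (0 : Y) ‖u₀‖).prod
    (isCompact_closedBall (0 : X) (κ * ‖u₀‖))).tendsto_subseq huv
  have hua : Tendsto (fun i => u (φ i)) atTop (𝓝 a) := (continuous_fst.tendsto _).comp hlim
  have hvb : Tendsto (fun i => v (φ i)) atTop (𝓝 b) := (continuous_snd.tendsto _).comp hlim
  have hba : b ∈ coderivative S x₀ y₀ a := mem_coderivative_of_tendsto (fun i => hv _) hua hvb
  have hle : ∀ h, c ≤ inner ℝ u₀ h → inner ℝ b q ≤ inner ℝ a h := by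
    intro h hh
    refine le_of_tendsto_of_tendsto (hvb.inner tendsto_const_nhds) (hua.inner tendsto_const_nhds) ?_
    obtain ⟨N, hN⟩ := exists_nat_ge ‖h‖
    filter_upwards [eventually_ge_atTop N] with i hi
    refine (hlt _ h ⟨hh, mem_closedBall_zero_iff.2 ?_⟩).le
    have : (N : ℝ) ≤ φ i := by exact_mod_cast hi.trans (hφ.id_le i)
    linarith [norm_nonneg e]
  simp only [mem_sphere_zero_iff_norm] at ha
  by_cases hau : a = u₀
  · subst hau
    have := hle e he'.ge
    linarith [hc b hba]
  · have hneg : inner ℝ a u₀ < ‖u₀‖ ^ 2 := by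
      have h1 : 0 < ‖a - u₀‖ ^ 2 := by
        have := norm_pos_iff.2 (sub_ne_zero.2 hau)
        positivity
      rw [norm_sub_sq_real, ha] at h1
      linarith
    set η := ‖u₀‖ ^ 2 - inner ℝ a u₀ with hη
    have hηpos : 0 < η := sub_pos.2 hneg
    set s := (|inner ℝ a e - inner ℝ b q| + 1) / η with hs
    have hspos : 0 < s := by positivity
    have h2 := hle (e + s • (u₀ - a)) (by
      rw [inner_add_right, he', real_inner_smul_right, inner_sub_right,
        real_inner_self_eq_norm_sq, real_inner_comm]
      nlinarith)
    rw [inner_add_right, real_inner_smul_right a (u₀ - a), inner_sub_right,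
      real_inner_self_eq_norm_sq, ha,
      ← neg_sub, ← hη] at h2
    have h3 : s * -η = -(|inner ℝ a e - inner ℝ b q| + 1) := by
      rw [hs]; field_simp
    rw [h3] at h2
    linarith [le_abs_self (inner ℝ a e - inner ℝ b q)]

/-- One inclusion between convexified coderivatives. -/
theorem convexifiedCoderivative_subset [Nontrivial X] {S₁ S₂ : X → Set Y} {x₁ x₂ : X} {y₁ y₂ : Y}
    (hgraph₁ : y₁ ∈ S₁ x₁) (hclosed₁ : LocallyClosedAt S₁ x₁ y₁) (hAubin₁ : AubinAt S₁ x₁ y₁)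
    (hAubin₂ : AubinAt S₂ x₂ y₂)
    (hprefans : prefanDerivatives S₁ x₁ y₁ ⊆ prefanDerivatives S₂ x₂ y₂) (u : Y) :
    convexifiedCoderivative S₂ x₂ y₂ u ⊆ convexifiedCoderivative S₁ x₁ y₁ u := by
  refine closure_minimal (convexHull_min (fun v hv => ?_) (convex_convexHull ℝ _).closure)
    isClosed_closure
  obtain ⟨κ₁, hκ₁⟩ := hAubin₁.exists_norm_le_of_mem_coderivative
  obtain ⟨κ₂, hκ₂⟩ := hAubin₂.exists_norm_le_of_mem_coderivative
  have hsub : coderivative S₁ x₁ y₁ u ⊆ convexifiedCoderivative S₁ x₁ y₁ u :=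
    (subset_convexHull ℝ _).trans subset_closure
  rcases eq_or_ne u 0 with rfl | hu
  · have : v = 0 := by simpa using hκ₂ _ v hv
    rw [this]
    exact hsub (zero_mem_coderivative hgraph₁)
  by_contra hnot
  obtain ⟨q, hq, c, hvc, hc⟩ : ∃ q : X, q ≠ 0 ∧ ∃ c : ℝ, inner ℝ v q < c ∧
      ∀ v' ∈ coderivative S₁ x₁ y₁ u, c < inner ℝ v' q := by
    -- If the set is empty, any nonzero $q$ separates, and one exists because $X$ is nontrivial.
    -- Otherwise $q=0$ would give $0<c<0$.
    rcases (coderivative S₁ x₁ y₁ u).eq_empty_or_nonempty with hemp | ⟨v', hv'⟩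
    · obtain ⟨q, hq⟩ := exists_ne (0 : X)
      exact ⟨q, hq, inner ℝ v q + 1, by linarith, by simp [hemp]⟩
    · obtain ⟨f, c, hfc, hf⟩ := geometric_hahn_banach_point_closed
        (convex_convexHull ℝ (coderivative S₁ x₁ y₁ u)).closure isClosed_closure hnot
      have hrep : ∀ a, inner ℝ a ((InnerProductSpace.toDual ℝ X).symm f) = f a := fun a => by
        rw [real_inner_comm, InnerProductSpace.toDual_symm_apply]
      refine ⟨(InnerProductSpace.toDual ℝ X).symm f, fun h0 => ?_, c, by rwa [hrep],
        fun a ha => by rw [hrep]; exact hf a (hsub ha)⟩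
      have h1 := hf v' (hsub hv')
      rw [← hrep, h0, inner_zero_right] at h1 hfc
      linarith
  obtain ⟨K, hKne, hKcvx, hKcpt, hKc, hK⟩ := exists_compact_convex_of_lt_coderivative hκ₁ hu hc
  obtain ⟨κ, hκ, hball⟩ := hAubin₁
  have hH : rayFan κ q K ∈ prefanDerivatives S₁ x₁ y₁ :=
    ⟨isPrefan_rayFan hκ hq hKne hKcvx hKcpt,
      pseudoStrictDiffAt_rayFan hq hgraph₁ hclosed₁ hball
        (fun v' hv' => by simpa using hκ₁ _ v' hv') hKcvx hKcpt hK⟩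
  have hval : rayFan κ q K q = K := by
    simpa using rayFan_smul_self (κ := κ) (K := K) hq one_pos
  obtain ⟨h, hh, hle⟩ := (hprefans hH).2.exists_inner_le_of_mem_coderivative
    (fun k hk w => rayFan_smul hq hk w) (q := q) (by rwa [hval]) hv
  rw [hval] at hh
  linarith [hKc h hh]

end Uniqueness

end VarAnalysis

theorem theorem5p7 {n m : ℕ} (hn : 1 ≤ n)
    (S₁ S₂ : EuclideanSpace ℝ (Fin n) → Set (EuclideanSpace ℝ (Fin m)))
    (x₁ x₂ : EuclideanSpace ℝ (Fin n)) (y₁ y₂ : EuclideanSpace ℝ (Fin m))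
    (hgraph₁ : y₁ ∈ S₁ x₁) (hgraph₂ : y₂ ∈ S₂ x₂)
    (hclosed₁ : VarAnalysis.LocallyClosedAt S₁ x₁ y₁)
    (hclosed₂ : VarAnalysis.LocallyClosedAt S₂ x₂ y₂)
    (hAubin₁ : VarAnalysis.AubinAt S₁ x₁ y₁)
    (hAubin₂ : VarAnalysis.AubinAt S₂ x₂ y₂)
    (hprefans : VarAnalysis.prefanDerivatives S₁ x₁ y₁ = VarAnalysis.prefanDerivatives S₂ x₂ y₂) :
    VarAnalysis.convexifiedCoderivative S₁ x₁ y₁ =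
      VarAnalysis.convexifiedCoderivative S₂ x₂ y₂ := by
  have : Nonempty (Fin n) := ⟨⟨0, hn⟩⟩
  funext u
  exact Set.Subset.antisymm
    (VarAnalysis.convexifiedCoderivative_subset hgraph₂ hclosed₂ hAubin₂ hAubin₁ hprefans.ge u)
    (VarAnalysis.convexifiedCoderivative_subset hgraph₁ hclosed₁ hAubin₁ hAubin₂ hprefans.le u)
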